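/- Let $[B]=\{1,\dots,B\}$ with $B\ge 1$. In a sequentially adaptive $\varepsilon$-LDP protocol with $n$ users, user $i$ holds $x_i\in[B]$ and sends one report $y_i=\mathcal M_i(x_i,y_1,\dots,y_{i-1})$, where for all fixed $y_1,\dots,y_{i-1}$ the randomized map $\mathcal M_i$ satisfies $\Pr[\mathcal M_i(x,y_1,\dots,y_{i-1})=y]\le e^{\varepsilon}\Pr[\mathcal M_i(x',y_1,\dots,y_{i-1})=y]$ for all $x,x'\in[B]$ and all $y$; the protocol outputs an estimate $\tilde m=\tilde m(y_1,\dots,y_n)\in[B]$. For a probability distribution $\mathcal D$ on $[B]$ let $F(i)=\Pr_{x\sim\mathcal D}[x\le i]$, and call $m\in[B]$ an $\alpha$-approximate median of $\mathcal D$ if $[F(m),F(m+1)]\cap(\tfrac12-\alpha,\tfrac12+\alpha)\neq\emptyset$. Theorem. For every $c>0$ there is a constant $C>0$, depending only on $c$, such that for all integers $B\ge1$, $n\ge 0$ and all reals $\alpha\in(0,\tfrac14)$, $\varepsilon>0$ with $$n\ \ge\ C\,\frac{\log B}{\alpha^2}\left(\frac{e^{\varepsilon}+1}{e^{\varepsilon}-1}\right)^2$$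 there is a sequentially adaptive $\varepsilon$-LDP protocol with $n$ users (not depending on $\mathcal D$) such that, for every distribution $\mathcal D$ on $[B]$, if $x_1,\dots,x_n$ are drawn independently from $\mathcal D$, then with probability at least $1-B^{-c}$ the estimate $\tilde m$ is an $\alpha$-approximate median of $\mathcal D$ if $\mathcal D$ has one in $[B]$, and $\tilde m=1$ otherwise (which is the case exactly when $\mathcal D(\{1\})\ge\frac12+\alpha$). -/

import Mathlib

namespace LDPMedian

/-- The ordered data domain `[B] = {1, …, B}`. -/
abbrev Dom (B : ℕ) : Type := Set.Icc 1 B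

/-- A randomized map (mechanism) `M` from data points in `[B]` to reports in `Y` is `ε`-locally
differentially private if `Pr[M(x) = y] ≤ e^ε Pr[M(x') = y]` for all `x`, `x'` and `y`. -/
def IsLDP {B : ℕ} {Y : Type} (ε : ℝ) (M : Dom B → PMF Y) : Prop :=
  ∀ (x x' : Dom B) (y : Y), M x y ≤ ENNReal.ofReal (Real.exp ε) * M x' y

/-- A sequentially adaptive protocol for `n` users holding data in `[B]`, with reports in `Y`.
Users are numbered `0, …, n - 1`: user `i` sees the `i` earlier reports `y` and sends a report
drawn from `mech i y x`, where `x` is the data point of the user. The aggregator computes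
its estimate from the `n` reports. (`mech i` is irrelevant for `i ≥ n`.) -/
structure Protocol (B n : ℕ) (Y : Type) where
  /-- The mechanism of user `i`, given the earlier reports. -/
  mech : (i : ℕ) → (Fin i → Y) → Dom B → PMF Y
  /-- The post-processing function of the aggregator. -/
  estimate : (Fin n → Y) → Dom B

namespace Protocol

variable {B n : ℕ} {Y : Type}

/-- Every user's mechanism is `ε`-LDP in the data point, for any fixed earlier reports. -/
def IsLDP (P : Protocol B n Y) (ε : ℝ) : Prop :=
  ∀ i < n, ∀ y : Fin i → Y, LDPMedian.IsLDP ε (P.mech i y)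

/-- The joint law of the first `t` reports when the users' data points are i.i.d. samples of `D`:
each new user draws a data point `x` from `D`, independently of everything before, and then
reports according to the user's mechanism. -/
noncomputable def reports (P : Protocol B n Y) (D : PMF (Dom B)) : (t : ℕ) → PMF (Fin t → Y)
  | 0 => PMF.pure Fin.elim0
  | t + 1 =>
      (P.reports D t).bind fun y =>
        D.bind fun x =>
          (P.mech t y x).map fun z => (Fin.snoc y z : Fin (t + 1) → Y)

/-- The law of the estimate when the `n` users' data points are i.i.d. samples of `D`. -/
noncomputable def output (P : Protocol B n Y) (D : PMF (Dom B)) : PMF (Dom B) :=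
  (P.reports D n).map P.estimate

/-- The probability that the estimate lies in `S`. -/
noncomputable def prob (P : Protocol B n Y) (D : PMF (Dom B)) (S : Set (Dom B)) : ℝ :=
  ((P.output D).toOuterMeasure S).toReal

end Protocol

/-- The cumulative distribution function `i ↦ ∑_{j ≤ i} D[j]`; it is `1` for `i ≥ B`. -/
noncomputable def cdf {B : ℕ} (D : PMF (Dom B)) (i : ℕ) : ℝ :=
  ∑ x : Dom B, if (x : ℕ) ≤ i then (D x).toReal else 0

/-- `m ∈ [B]` is an `α`-approximate median of `D` if `[F(m), F(m + 1)]` meets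
`(1/2 - α, 1/2 + α)`, where `F` is the cumulative distribution function of `D`. -/
def IsApproxMedian {B : ℕ} (D : PMF (Dom B)) (α : ℝ) (m : Dom B) : Prop :=
  (Set.Icc (cdf D m) (cdf D (m + 1)) ∩ Set.Ioo (1 / 2 - α) (1 / 2 + α)).Nonempty

end LDPMedian

/-! Noisy binary search by multiplicative weights over the gaps `g < B` between `g` and `g + 1`.
Each user is asked, by randomized response, about an end point of the weighted median gap, and the
answer shifts weight by factors `1 ± η`. The median gap gets a fractional share (`tilt`) that keeps
the total weight exactly `B`, whatever the answer (`sum_weight`).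

Fix a gap `g` at which the distribution function `F` crosses `1/2`, and let `γ = (e^ε - 1) / (e^ε +
1)` be the bias kept by randomized response. The drift of the weight of `g` is never against it
(`side_mul_cdf_nonneg`), and it is at least `αγ`, in units of `η`, whenever the median gap is far
(`le_side_mul_cdf_of_isFar`). With `2η = αγ`, the inverse weight of `g`, corrected for elapsed time
and far visits, is therefore a supermartingale (`sum_potential_snoc_le`) starting at `1`.

The output is a median of the visited gaps. If it is far, so were at least half of the visits; since
the weight of `g` is at most `B`, the potential is then at least `e^(η²n) / B`
(`one_le_mul_potential`). Markov's inequality bounds the failure probability by `B e^(-η²n)`. -/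

namespace LDPMedian

open Finset

/-! ### Weighted medians and a balanced multiplicative update -/

section Median

variable {B : ℕ} {w : ℕ → ℝ}

/-- `m < B` is a weighted median of the weights `w 0, …, w (B - 1)`. -/
def IsWeightedMedian (B : ℕ) (w : ℕ → ℝ) (m : ℕ) : Prop :=
  m < B ∧ 2 * ∑ g ∈ range m, w g ≤ ∑ g ∈ range B, w g ∧
    ∑ g ∈ range B, w g ≤ 2 * ∑ g ∈ range (m + 1), w g

lemma exists_isWeightedMedian (hB : 1 ≤ B) (hw : ∀ g, 0 ≤ w g) :
    ∃ m, IsWeightedMedian B w m := by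
  classical
  have hex : ∃ m, ∑ g ∈ range B, w g ≤ 2 * ∑ g ∈ range (m + 1), w g := by
    refine ⟨B - 1, ?_⟩
    rw [Nat.sub_add_cancel hB]
    linarith [sum_nonneg (s := range B) fun g _ => hw g]
  have hle : Nat.find hex ≤ B - 1 := by
    refine Nat.find_min' hex ?_
    rw [Nat.sub_add_cancel hB]
    linarith [sum_nonneg (s := range B) fun g _ => hw g]
  refine ⟨Nat.find hex, by omega, ?_, Nat.find_spec hex⟩
  rcases Nat.eq_zero_or_pos (Nat.find hex) with h0 | h0
  · rw [h0]
    simpa using sum_nonneg fun g _ => hw g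
  · have := Nat.find_min hex (m := Nat.find hex - 1) (by omega)
    rw [Nat.sub_add_cancel h0] at this
    linarith

/-- A weighted median of the weights `w 0, …, w (B - 1)`. -/
noncomputable def weightedMedian (B : ℕ) (w : ℕ → ℝ) : ℕ :=
  Classical.epsilon (IsWeightedMedian B w)

lemma isWeightedMedian_weightedMedian (hB : 1 ≤ B) (hw : ∀ g, 0 ≤ w g) :
    IsWeightedMedian B w (weightedMedian B w) :=
  Classical.epsilon_spec (exists_isWeightedMedian hB hw)

/-- The share in `[-1, 1]` of the median that balances the weight on its left with the weight
on its right. -/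
noncomputable def tilt (B : ℕ) (w : ℕ → ℝ) : ℝ :=
  (∑ g ∈ range B, w g - 2 * ∑ g ∈ range (weightedMedian B w), w g - w (weightedMedian B w)) /
    w (weightedMedian B w)

/-- The direction in which the weight of `g` moves when the report favours small values. -/
noncomputable def side (B : ℕ) (w : ℕ → ℝ) (g : ℕ) : ℝ :=
  if g < weightedMedian B w then 1 else if g = weightedMedian B w then tilt B w else -1

/-- The two inequalities defining a weighted median are exactly the two sides of this bound. -/
lemma abs_tilt_le_one (hB : 1 ≤ B) (hw : ∀ g, 0 < w g) : |tilt B w| ≤ 1 := by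
  obtain ⟨-, h1, h2⟩ := isWeightedMedian_weightedMedian hB fun g => (hw g).le
  rw [sum_range_succ] at h2
  rw [tilt, abs_div, abs_of_pos (hw _), div_le_one (hw _), abs_le]
  constructor <;> linarith

lemma abs_side_le_one (hB : 1 ≤ B) (hw : ∀ g, 0 < w g) (g : ℕ) : |side B w g| ≤ 1 := by
  unfold side
  split_ifs
  · simp
  · exact abs_tilt_le_one hB hw
  · simp

lemma sum_mul_side (hB : 1 ≤ B) (hw : ∀ g, 0 < w g) :
    ∑ g ∈ range B, w g * side B w g = 0 := by
  obtain ⟨hm, -, -⟩ := isWeightedMedian_weightedMedian hB fun g => (hw g).le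
  have htilt : w (weightedMedian B w) * tilt B w = ∑ g ∈ range B, w g -
      2 * ∑ g ∈ range (weightedMedian B w), w g - w (weightedMedian B w) := by
    rw [tilt, mul_div_cancel₀ _ (hw _).ne']
  have hsplit : ∀ f : ℕ → ℝ, ∑ g ∈ range B, f g = ∑ g ∈ range (weightedMedian B w), f g +
      f (weightedMedian B w) + ∑ g ∈ Ico (weightedMedian B w + 1) B, f g := fun f => by
    rw [← sum_range_succ, sum_range_add_sum_Ico _ (by omega)]
  have hl : ∑ g ∈ range (weightedMedian B w), w g * side B w g =
      ∑ g ∈ range (weightedMedian B w), w g :=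
    sum_congr rfl fun g hg => by simp [side, mem_range.1 hg]
  have hr : ∑ g ∈ Ico (weightedMedian B w + 1) B, w g * side B w g =
      -∑ g ∈ Ico (weightedMedian B w + 1) B, w g := by
    rw [← sum_neg_distrib]
    refine sum_congr rfl fun g hg => ?_
    have := (mem_Ico.1 hg).1
    rw [side, if_neg (by omega), if_neg (by omega), mul_neg_one]
  have hc : side B w (weightedMedian B w) = tilt B w := by simp [side]
  rw [hsplit, hl, hr, hc, htilt, hsplit w]
  ring

/-- The threshold to ask about: an end point of the median gap, on the side of its tilt. -/
noncomputable def query (B : ℕ) (w : ℕ → ℝ) : ℕ :=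
  if 0 ≤ tilt B w then weightedMedian B w + 1 else weightedMedian B w

/-- The sign of a report. -/
def reportSign (s : Bool) : ℝ := if s then 1 else -1

/-- The weights after the report `s`. -/
noncomputable def reweight (B : ℕ) (η : ℝ) (w : ℕ → ℝ) (s : Bool) (g : ℕ) : ℝ :=
  w g * (1 + reportSign s * η * side B w g)

/-- No normalization is needed after a report: the first-order change vanishes by `sum_mul_side`,
and the update is linear in `η`. -/
lemma sum_reweight (hB : 1 ≤ B) (hw : ∀ g, 0 < w g) (η : ℝ) (s : Bool) :
    ∑ g ∈ range B, reweight B η w s g = ∑ g ∈ range B, w g := by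
  have : ∀ g, reweight B η w s g = w g + reportSign s * η * (w g * side B w g) := fun g => by
    unfold reweight; ring
  simp_rw [this, sum_add_distrib, ← mul_sum, sum_mul_side hB hw]
  simp

lemma abs_mul_side_lt_one (hB : 1 ≤ B) (hw : ∀ g, 0 < w g) {η : ℝ} (h0 : 0 < η) (h1 : η < 1)
    (g : ℕ) : |η * side B w g| < 1 := by
  rw [abs_mul, abs_of_pos h0]
  nlinarith [abs_side_le_one hB hw g, abs_nonneg (side B w g)]

lemma reweight_pos (hB : 1 ≤ B) (hw : ∀ g, 0 < w g) {η : ℝ} (h0 : 0 < η) (h1 : η < 1)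
    (s : Bool) (g : ℕ) : 0 < reweight B η w s g := by
  have h := abs_lt.1 (abs_mul_side_lt_one hB hw h0 h1 g)
  refine mul_pos (hw g) ?_
  cases s <;> simp [reportSign] <;> linarith

end Median

/-! ### The state of the search after a sequence of reports -/

section State

variable {B : ℕ} {η : ℝ}

/-- The weights of the gaps after the reports `y`. -/
noncomputable def weight (B : ℕ) (η : ℝ) : (t : ℕ) → (Fin t → Bool) → ℕ → ℝ
  | 0, _ => fun _ => 1
  | t + 1, y => reweight B η (weight B η t (Fin.init y)) (y (Fin.last t))

/-- The median gap after the reports `y`. -/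
noncomputable def currentGap (B : ℕ) (η : ℝ) (t : ℕ) (y : Fin t → Bool) : ℕ :=
  weightedMedian B (weight B η t y)

/-- How often each gap was the median gap while the reports `y` came in. -/
noncomputable def visits (B : ℕ) (η : ℝ) : (t : ℕ) → (Fin t → Bool) → ℕ → ℕ
  | 0, _ => fun _ => 0
  | t + 1, y => fun g => visits B η t (Fin.init y) g +
      if g = currentGap B η t (Fin.init y) then 1 else 0

lemma weight_snoc (t : ℕ) (y : Fin t → Bool) (s : Bool) :
    weight B η (t + 1) (Fin.snoc y s : Fin (t + 1) → Bool) = reweight B η (weight B η t y) s := by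
  simp [weight]

lemma visits_snoc (t : ℕ) (y : Fin t → Bool) (s : Bool) (g : ℕ) :
    visits B η (t + 1) (Fin.snoc y s : Fin (t + 1) → Bool) g =
      visits B η t y g + if g = currentGap B η t y then 1 else 0 := by
  simp [visits]

lemma weight_pos (hB : 1 ≤ B) (h0 : 0 < η) (h1 : η < 1) :
    ∀ (t : ℕ) (y : Fin t → Bool) (g : ℕ), 0 < weight B η t y g
  | 0, _, _ => one_pos
  | t + 1, _, g => reweight_pos hB (weight_pos hB h0 h1 t _) h0 h1 _ g

lemma sum_weight (hB : 1 ≤ B) (h0 : 0 < η) (h1 : η < 1) :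
    ∀ (t : ℕ) (y : Fin t → Bool), ∑ g ∈ range B, weight B η t y g = B
  | 0, _ => by simp [weight]
  | t + 1, y => by
      rw [weight, sum_reweight hB (weight_pos hB h0 h1 t _), sum_weight hB h0 h1 t]

lemma weight_le (hB : 1 ≤ B) (h0 : 0 < η) (h1 : η < 1) (t : ℕ) (y : Fin t → Bool) {g : ℕ}
    (hg : g < B) : weight B η t y g ≤ B := by
  rw [← sum_weight hB h0 h1 t y]
  exact single_le_sum (fun i _ => (weight_pos hB h0 h1 t y i).le) (mem_range.2 hg)

lemma currentGap_lt (hB : 1 ≤ B) (h0 : 0 < η) (h1 : η < 1) (t : ℕ) (y : Fin t → Bool) :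
    currentGap B η t y < B :=
  (isWeightedMedian_weightedMedian hB fun g => (weight_pos hB h0 h1 t y g).le).1

lemma sum_visits (hB : 1 ≤ B) (h0 : 0 < η) (h1 : η < 1) :
    ∀ (t : ℕ) (y : Fin t → Bool), ∑ g ∈ range B, visits B η t y g = t
  | 0, _ => by simp [visits]
  | t + 1, y => by
      simp [visits, sum_add_distrib, sum_visits hB h0 h1 t, currentGap_lt hB h0 h1]

open Classical in
/-- How often a gap with the property `p` was the median gap. -/
noncomputable def visitsTo (B : ℕ) (η : ℝ) (p : ℕ → Prop) (t : ℕ) (y : Fin t → Bool) : ℕ :=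
  ∑ g ∈ range B with p g, visits B η t y g

open Classical in
lemma visitsTo_snoc (hB : 1 ≤ B) (h0 : 0 < η) (h1 : η < 1) (p : ℕ → Prop) (t : ℕ)
    (y : Fin t → Bool) (s : Bool) :
    visitsTo B η p (t + 1) (Fin.snoc y s : Fin (t + 1) → Bool) =
      visitsTo B η p t y + if p (currentGap B η t y) then 1 else 0 := by
  simp [visitsTo, visits_snoc, sum_add_distrib, currentGap_lt hB h0 h1]

/-- The gap returned by the search: a median of the visited gaps. -/
noncomputable def finalGap (B : ℕ) (η : ℝ) (t : ℕ) (y : Fin t → Bool) : ℕ :=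
  weightedMedian B fun g => (visits B η t y g : ℝ)

lemma finalGap_lt (hB : 1 ≤ B) (t : ℕ) (y : Fin t → Bool) : finalGap B η t y < B :=
  (isWeightedMedian_weightedMedian hB fun _ => Nat.cast_nonneg _).1

/-- If the complement of `p` is an interval, in the sense that `p` propagates upwards or downwards
from each of its points, then the final gap has the property `p` only if at least half of the
visited gaps have it. -/
lemma le_two_mul_visitsTo (hB : 1 ≤ B) (h0 : 0 < η) (h1 : η < 1) (t : ℕ) (y : Fin t → Bool)
    (p : ℕ → Prop) (hp : (∀ g, finalGap B η t y ≤ g → p g) ∨ ∀ g ≤ finalGap B η t y, p g) :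
    t ≤ 2 * visitsTo B η p t y := by
  classical
  obtain ⟨hm, hl', hr'⟩ : IsWeightedMedian B (fun g => (visits B η t y g : ℝ)) (finalGap B η t y) :=
    isWeightedMedian_weightedMedian hB fun _ => Nat.cast_nonneg _
  have hl : 2 * ∑ g ∈ range (finalGap B η t y), visits B η t y g ≤
      ∑ g ∈ range B, visits B η t y g := by
    beta_reduce at hl'
    exact_mod_cast hl'
  have hr : ∑ g ∈ range B, visits B η t y g ≤
      2 * ∑ g ∈ range (finalGap B η t y + 1), visits B η t y g := by
    beta_reduce at hr'
    exact_mod_cast hr'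
  have hsum := sum_visits hB h0 h1 t y
  rcases hp with hp | hp
  · have hsplit := sum_range_add_sum_Ico (visits B η t y) hm.le
    have : ∑ g ∈ Ico (finalGap B η t y) B, visits B η t y g ≤ visitsTo B η p t y := by
      refine sum_le_sum_of_subset fun g hg => ?_
      rw [mem_Ico] at hg
      simp [hg.2, hp g hg.1]
    omega
  · have : ∑ g ∈ range (finalGap B η t y + 1), visits B η t y g ≤ visitsTo B η p t y := by
      refine sum_le_sum_of_subset fun g hg => ?_
      rw [mem_range] at hg
      simp [hp g (by omega)]
      omega
    omega

end State

/-! ### Expectations over the reports of a protocol -/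

section Expectation

variable {B n : ℕ} {Y : Type} [Fintype Y]

/-- The expectation of a function of the first `t` reports. -/
noncomputable def Protocol.expect (P : Protocol B n Y) (D : PMF (Dom B)) (t : ℕ)
    (f : (Fin t → Y) → ℝ) : ℝ :=
  ∑ y, (P.reports D t y).toReal * f y

lemma Protocol.expect_mono (P : Protocol B n Y) (D : PMF (Dom B)) {t : ℕ}
    {f f' : (Fin t → Y) → ℝ} (h : ∀ y, f y ≤ f' y) : P.expect D t f ≤ P.expect D t f' :=
  sum_le_sum fun y _ => mul_le_mul_of_nonneg_left (h y) ENNReal.toReal_nonneg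

lemma sum_toReal_pmf {α : Type*} [Fintype α] (p : PMF α) : ∑ a, (p a).toReal = 1 := by
  rw [← ENNReal.toReal_sum fun a _ => p.apply_ne_top a, ← tsum_fintype (L := .unconditional _),
    p.tsum_coe, ENNReal.toReal_one]

lemma Protocol.expect_one_sub_mul (P : Protocol B n Y) (D : PMF (Dom B)) (t : ℕ) (a : ℝ)
    (f : (Fin t → Y) → ℝ) :
    P.expect D t (fun y => 1 - a * f y) = 1 - a * P.expect D t f := by
  simp only [Protocol.expect, mul_sub, mul_one, sum_sub_distrib, sum_toReal_pmf, mul_sum]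
  congr 1
  exact sum_congr rfl fun y _ => by ring

open Classical in
lemma Protocol.prob_eq_expect (P : Protocol B n Y) (D : PMF (Dom B)) (S : Set (Dom B)) :
    P.prob D S = P.expect D n fun y => if P.estimate y ∈ S then 1 else 0 := by
  rw [Protocol.prob, Protocol.output, PMF.toOuterMeasure_map_apply,
    PMF.toOuterMeasure_apply_fintype, ENNReal.toReal_sum, Protocol.expect]
  · refine sum_congr rfl fun y _ => ?_
    by_cases h : P.estimate y ∈ S <;> simp [h]
  · intro y _
    by_cases h : P.estimate y ∈ S <;> simp [h, PMF.apply_ne_top]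

/-- `Fin.snoc` is injective, so only one pair of history and last report contributes to the sums. -/
lemma Protocol.reports_snoc (P : Protocol B n Y) (D : PMF (Dom B)) (t : ℕ) (y : Fin t → Y)
    (z : Y) : P.reports D (t + 1) (Fin.snoc y z : Fin (t + 1) → Y) =
      P.reports D t y * (D.bind (P.mech t y)) z := by
  classical
  rw [Protocol.reports, PMF.bind_apply, tsum_fintype, sum_eq_single y]
  · congr 1
    simp only [PMF.bind_apply, PMF.map_apply, tsum_fintype]
    refine sum_congr rfl fun x _ => ?_
    congr 1
    rw [sum_eq_single z]
    · simp
    · intro z' _ hz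
      rw [if_neg]
      intro h
      exact hz (Fin.snoc_injective2 h).2.symm
    · simp
  · intro y' _ hy
    refine mul_eq_zero_of_right _ ?_
    simp only [PMF.bind_apply, PMF.map_apply, tsum_fintype]
    refine sum_eq_zero fun x _ => mul_eq_zero_of_right _ (sum_eq_zero fun z' _ => ?_)
    rw [if_neg]
    intro h
    exact hy (Fin.snoc_injective2 h).1.symm
  · simp

lemma Protocol.expect_succ (P : Protocol B n Y) (D : PMF (Dom B)) (t : ℕ)
    (f : (Fin (t + 1) → Y) → ℝ) :
    P.expect D (t + 1) f =
      P.expect D t fun y => ∑ z, (D.bind (P.mech t y) z).toReal * f (Fin.snoc y z) := by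
  rw [Protocol.expect, ← (Fin.snocEquiv fun _ => Y).sum_comp, Fintype.sum_prod_type_right,
    Protocol.expect]
  refine sum_congr rfl fun y _ => ?_
  rw [mul_sum]
  refine sum_congr rfl fun z _ => ?_
  change (P.reports D (t + 1) (Fin.snoc y z : Fin (t + 1) → Y)).toReal * f (Fin.snoc y z) = _
  rw [P.reports_snoc, ENNReal.toReal_mul, mul_assoc]

end Expectation

/-! ### Randomized response -/

section RandomizedResponse

variable {B : ℕ} {ε : ℝ}

/-- Report the bit `b` with probability `e^ε / (e^ε + 1)` and its negation otherwise. -/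
noncomputable def randomizedResponse (ε : ℝ) (b : Bool) : PMF Bool :=
  PMF.ofFintype (fun z => ENNReal.ofReal (if z = b then Real.exp ε / (Real.exp ε + 1)
    else 1 / (Real.exp ε + 1))) (by
      have := Real.exp_pos ε
      cases b <;> simp <;> rw [← ENNReal.ofReal_add (by positivity) (by positivity),
        ENNReal.ofReal_eq_one] <;> field_simp <;> ring)

lemma randomizedResponse_le (hε : 0 < ε) (b b' z : Bool) : randomizedResponse ε b z ≤
    ENNReal.ofReal (Real.exp ε) * randomizedResponse ε b' z := by
  have h1 : 1 < Real.exp ε := Real.one_lt_exp_iff.2 hε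
  simp only [randomizedResponse, PMF.ofFintype_apply]
  rw [← ENNReal.ofReal_mul (by positivity)]
  refine ENNReal.ofReal_le_ofReal ?_
  split_ifs
  · rw [← mul_div_assoc]
    gcongr
    nlinarith
  · rw [mul_one_div]
  · rw [← mul_div_assoc]
    gcongr
    nlinarith
  · rw [mul_one_div]
    gcongr

/-- The randomized answer to the question whether `x ≤ j`. -/
noncomputable def thresholdResponse (ε : ℝ) (j : ℕ) (x : Dom B) : PMF Bool :=
  randomizedResponse ε (decide ((x : ℕ) ≤ j))

/-- Privacy costs only the factor `(e^ε - 1) / (e^ε + 1)` in the bias of the answer, which is the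
source of its inverse square in the sample size. -/
lemma toReal_bind_thresholdResponse (D : PMF (Dom B)) (ε : ℝ) (j : ℕ) (s : Bool) :
    (D.bind (thresholdResponse ε j) s).toReal = 1 / 2 + reportSign s *
      ((Real.exp ε - 1) / (Real.exp ε + 1)) * (cdf D j - 1 / 2) := by
  have he := Real.exp_pos ε
  have key : ∀ x : Dom B, (D x * thresholdResponse ε j x s).toReal =
      (D x).toReal * (1 / 2 - reportSign s * ((Real.exp ε - 1) / (Real.exp ε + 1)) / 2) +
      (reportSign s * ((Real.exp ε - 1) / (Real.exp ε + 1))) *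
        (if (x : ℕ) ≤ j then (D x).toReal else 0) := by
    intro x
    rw [ENNReal.toReal_mul, thresholdResponse, randomizedResponse, PMF.ofFintype_apply,
      ENNReal.toReal_ofReal (by split_ifs <;> positivity)]
    by_cases h : (x : ℕ) ≤ j <;> cases s <;> simp [h, reportSign, -mul_eq_mul_left_iff] <;>
      field_simp <;> ring
  rw [PMF.bind_apply, tsum_fintype, ENNReal.toReal_sum fun x _ =>
    ENNReal.mul_ne_top (D.apply_ne_top x) (PMF.apply_ne_top _ s)]
  simp_rw [key, sum_add_distrib, ← sum_mul, ← mul_sum, sum_toReal_pmf]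
  rw [cdf]
  ring

end RandomizedResponse

/-! ### Cumulative distribution functions -/

section Cdf

variable {B : ℕ} (D : PMF (Dom B))

lemma cdf_mono : Monotone (cdf D) := by
  intro i j hij
  refine sum_le_sum fun x _ => ?_
  split_ifs with h1 h2
  · exact le_rfl
  · omega
  · exact ENNReal.toReal_nonneg
  · exact le_rfl

lemma cdf_zero : cdf D 0 = 0 := by
  refine sum_eq_zero fun x _ => if_neg ?_
  have := x.2.1
  omega

lemma cdf_of_le {i : ℕ} (hi : B ≤ i) : cdf D i = 1 := by
  rw [← sum_toReal_pmf D, cdf]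
  exact sum_congr rfl fun x _ => if_pos (x.2.2.trans hi)

lemma exists_crossing (hB : 1 ≤ B) :
    ∃ g < B, cdf D g ≤ 1 / 2 ∧ 1 / 2 ≤ cdf D (g + 1) := by
  classical
  have hex : ∃ j, 1 / 2 ≤ cdf D j := ⟨B, by rw [cdf_of_le D le_rfl]; norm_num⟩
  have hpos : Nat.find hex ≠ 0 := fun h => by
    have := Nat.find_spec hex
    rw [h, cdf_zero] at this
    norm_num at this
  have hle : Nat.find hex ≤ B := Nat.find_min' hex (by rw [cdf_of_le D le_rfl]; norm_num)
  refine ⟨Nat.find hex - 1, by omega, (not_le.1 (Nat.find_min hex (by omega))).le, ?_⟩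
  rw [Nat.sub_add_cancel (by omega)]
  exact Nat.find_spec hex

/-- The gap between `g` and `g + 1` is far from the median. -/
def IsFar (α : ℝ) (g : ℕ) : Prop :=
  1 / 2 + α ≤ cdf D g ∨ cdf D (g + 1) ≤ 1 / 2 - α

variable {D} {α : ℝ}

lemma isApproxMedian_iff (hα : 0 < α) (m : Dom B) :
    IsApproxMedian D α m ↔ cdf D m < 1 / 2 + α ∧ 1 / 2 - α < cdf D (m + 1) := by
  have hmono := cdf_mono D (Nat.le_succ (m : ℕ))
  constructor
  · rintro ⟨x, ⟨h1, h2⟩, h3, h4⟩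
    exact ⟨by linarith, by linarith⟩
  · rintro ⟨h1, h2⟩
    by_cases h : 1 / 2 - α < cdf D m
    · exact ⟨cdf D m, ⟨le_rfl, hmono⟩, h, h1⟩
    · by_cases h' : cdf D (m + 1) < 1 / 2 + α
      · exact ⟨cdf D (m + 1), ⟨hmono, le_rfl⟩, h2, h'⟩
      -- Here the closed interval covers the whole open window, so its centre serves.
      · exact ⟨1 / 2, ⟨by linarith, by linarith⟩, by linarith, by linarith⟩

/-- Gap `0` is not a point of `[B]` and is rounded up to `1`. This is harmless once some approximate
median `m'` exists, because `F(1) ≤ F(m') < 1/2 + α`. -/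
lemma isApproxMedian_of_not_isFar (hα : 0 < α) {g : ℕ} (hg : ¬ IsFar D α g) (m : Dom B)
    (hm : (m : ℕ) = max 1 g) (hex : ∃ m', IsApproxMedian D α m') : IsApproxMedian D α m := by
  simp only [IsFar, not_or, not_le] at hg
  rw [isApproxMedian_iff hα]
  refine ⟨?_, hg.2.trans_le (cdf_mono D (by omega))⟩
  rcases Nat.eq_zero_or_pos g with rfl | h0
  · obtain ⟨m', hm'⟩ := hex
    rw [isApproxMedian_iff hα] at hm'
    refine lt_of_le_of_lt (cdf_mono D ?_) hm'.1
    rw [hm]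
    exact m'.2.1
  · rw [hm, max_eq_right h0]
    exact hg.1

lemma eq_zero_of_not_isFar (hα : 0 < α) {g : ℕ} (hg : ¬ IsFar D α g) (hgB : g < B)
    (hex : ¬ ∃ m', IsApproxMedian D α m') : g = 0 := by
  by_contra h0
  simp only [IsFar, not_or, not_le] at hg
  exact hex ⟨⟨g, by omega, hgB.le⟩, (isApproxMedian_iff hα _).2 hg⟩

end Cdf

/-! ### The search protocol and its analysis -/

section Search

variable {B n : ℕ} {ε η : ℝ}

/-- Each user answers the threshold query of the multiplicative-weights search by randomized
response; the estimate is the median of the visited gaps. -/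
noncomputable def searchProtocol (B n : ℕ) (hB : 1 ≤ B) (ε η : ℝ) : Protocol B n Bool where
  mech t y := thresholdResponse ε (query B (weight B η t y))
  estimate y := ⟨max 1 (finalGap B η n y), le_max_left _ _, max_le hB (finalGap_lt hB n y).le⟩

lemma searchProtocol_isLDP (hB : 1 ≤ B) (hε : 0 < ε) : (searchProtocol B n hB ε η).IsLDP ε :=
  fun _ _ _ _ _ z => randomizedResponse_le hε _ _ z

/-- The weight of a gap at which the distribution function crosses `1/2` moves in the right
direction on average. -/
lemma side_mul_cdf_nonneg (D : PMF (Dom B)) (w : ℕ → ℝ) {g : ℕ} (hl : cdf D g ≤ 1 / 2)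
    (hr : 1 / 2 ≤ cdf D (g + 1)) : 0 ≤ side B w g * (cdf D (query B w) - 1 / 2) := by
  unfold side query
  rcases lt_trichotomy g (weightedMedian B w) with h | h | h
  · rw [if_pos h, one_mul]
    have := cdf_mono D (show g + 1 ≤ if 0 ≤ tilt B w then weightedMedian B w + 1
      else weightedMedian B w by split_ifs <;> omega)
    linarith
  · rw [if_neg h.not_lt, if_pos h, ← h]
    split_ifs with ht
    · exact mul_nonneg ht (by linarith)
    · exact mul_nonneg_of_nonpos_of_nonpos (by linarith) (by linarith)
  · rw [if_neg h.not_gt, if_neg h.ne']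
    have := cdf_mono D (show (if 0 ≤ tilt B w then weightedMedian B w + 1
      else weightedMedian B w) ≤ g by split_ifs <;> omega)
    linarith

/-- A far median gap cannot be the crossing gap, so `side` is `1` or `-1` there; both end points of
the median gap, hence either query, lie beyond the `α` margin. -/
lemma le_side_mul_cdf_of_isFar (D : PMF (Dom B)) (w : ℕ → ℝ) {g : ℕ} {α : ℝ} (hα : 0 < α)
    (hl : cdf D g ≤ 1 / 2) (hr : 1 / 2 ≤ cdf D (g + 1)) (hfar : IsFar D α (weightedMedian B w)) :
    α ≤ side B w g * (cdf D (query B w) - 1 / 2) := by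
  have hq1 : weightedMedian B w ≤ query B w := by unfold query; split_ifs <;> omega
  have hq2 : query B w ≤ weightedMedian B w + 1 := by unfold query; split_ifs <;> omega
  unfold side
  rcases hfar with h | h
  · have hlt : g < weightedMedian B w := by
      by_contra hge
      have := cdf_mono D (not_lt.1 hge)
      linarith
    rw [if_pos hlt, one_mul]
    have := cdf_mono D hq1
    linarith
  · have hlt : weightedMedian B w < g := by
      by_contra hge
      have := cdf_mono D (Nat.succ_le_succ (not_lt.1 hge))
      simp only [Nat.succ_eq_add_one] at this
      linarith
    rw [if_neg (by omega), if_neg (by omega)]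
    have := cdf_mono D hq2
    linarith

/-- Over a common denominator the left side equals `(1 - 2ησδ) / (1 - η²σ²)`; then `σ² ≤ 1` is used.
-/
lemma expect_inv_le {η σ δ : ℝ} (h0 : 0 < η) (h1 : η < 1) (hσ : |σ| ≤ 1)
    (hδ : |δ| ≤ 1 / 2) : (1 / 2 + δ) * (1 + η * σ)⁻¹ + (1 / 2 - δ) * (1 - η * σ)⁻¹ ≤
      (1 - 2 * η * (σ * δ)) * (1 - η ^ 2)⁻¹ := by
  have hησ : |η * σ| < 1 := by
    rw [abs_mul, abs_of_pos h0]
    nlinarith [abs_nonneg σ]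
  obtain ⟨hl, hr⟩ := abs_lt.1 hησ
  have hσδ : σ * δ ≤ 1 / 2 := by
    refine (le_abs_self _).trans ?_
    rw [abs_mul]
    nlinarith [abs_nonneg σ, abs_nonneg δ]
  have hsq : η ^ 2 * σ ^ 2 ≤ η ^ 2 := by
    have : σ ^ 2 ≤ 1 := by rwa [sq_le_one_iff_abs_le_one]
    nlinarith [sq_nonneg η]
  have hη : 0 < 1 - η ^ 2 := by nlinarith
  have hp : (1 + η * σ) ≠ 0 := by linarith
  have hm : (1 - η * σ) ≠ 0 := by linarith
  calc (1 / 2 + δ) * (1 + η * σ)⁻¹ + (1 / 2 - δ) * (1 - η * σ)⁻¹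
      = (1 - 2 * η * (σ * δ)) * (1 - η ^ 2 * σ ^ 2)⁻¹ := by
        rw [show 1 - η ^ 2 * σ ^ 2 = (1 + η * σ) * (1 - η * σ) by ring]
        field_simp
        ring
    _ ≤ _ := by
        refine mul_le_mul_of_nonneg_left (inv_anti₀ hη (by linarith)) ?_
        nlinarith

/-- The exponential potential of the gap `g`: it decreases on average, although every visit to a
gap with the property `p` increases it. -/
noncomputable def potential (B : ℕ) (η : ℝ) (p : ℕ → Prop) (g t : ℕ) (y : Fin t → Bool) : ℝ :=
  (1 - η ^ 2) ^ t * (weight B η t y g)⁻¹ * ((1 - η ^ 2) ^ (4 * visitsTo B η p t y))⁻¹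

lemma sum_potential_snoc_le (hB : 1 ≤ B) {α : ℝ} (hα : 0 < α) (h0 : 0 < η) (h1 : η < 1)
    (hη : 2 * η = α * ((Real.exp ε - 1) / (Real.exp ε + 1))) (D : PMF (Dom B)) {g : ℕ}
    (hl : cdf D g ≤ 1 / 2) (hr : 1 / 2 ≤ cdf D (g + 1)) (t : ℕ) (y : Fin t → Bool) :
    ∑ s, (D.bind (thresholdResponse ε (query B (weight B η t y))) s).toReal *
        potential B η (IsFar D α) g (t + 1) (Fin.snoc y s) ≤
      potential B η (IsFar D α) g t y := by
  classical
  set w := weight B η t y with hw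
  have hwpos : ∀ g, 0 < w g := weight_pos hB h0 h1 t y
  set γ := (Real.exp ε - 1) / (Real.exp ε + 1) with hγ
  have hγpos : 0 < γ := by
    by_contra h
    nlinarith
  set δ := γ * (cdf D (query B w) - 1 / 2) with hδ
  have hσδ : side B w g * δ = γ * (side B w g * (cdf D (query B w) - 1 / 2)) := by ring
  have htrue : (D.bind (thresholdResponse ε (query B w)) true).toReal = 1 / 2 + δ := by
    rw [toReal_bind_thresholdResponse]
    simp [reportSign, hδ, hγ]
  have hfalse : (D.bind (thresholdResponse ε (query B w)) false).toReal = 1 / 2 - δ := by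
    rw [toReal_bind_thresholdResponse]
    simp [reportSign, hδ, hγ]
    ring
  have hδle : |δ| ≤ 1 / 2 := by
    -- Both `1/2 + δ` and `1/2 - δ` are probabilities.
    have ht := htrue ▸ ENNReal.toReal_nonneg
    have hf := hfalse ▸ ENNReal.toReal_nonneg
    exact abs_le.2 ⟨by linarith, by linarith⟩
  have hq : 0 < 1 - η ^ 2 := by nlinarith
  set k := if IsFar D α (weightedMedian B w) then 1 else 0 with hk
  have hstep : ∀ s, potential B η (IsFar D α) g (t + 1) (Fin.snoc y s) =
      potential B η (IsFar D α) g t y * ((1 - η ^ 2) * ((1 - η ^ 2) ^ (4 * k))⁻¹) *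
        (1 + reportSign s * η * side B w g)⁻¹ := by
    intro s
    rw [potential, potential, visitsTo_snoc hB h0 h1, weight_snoc, currentGap, ← hw, reweight,
      ← hk, Nat.mul_add, pow_add _ (4 * _), pow_succ (1 - η ^ 2) t, mul_inv, mul_inv]
    ring
  have hdrift : 1 - 2 * η * (side B w g * δ) ≤ (1 - η ^ 2) ^ (4 * k) := by
    by_cases hfar : IsFar D α (weightedMedian B w)
    · have := le_side_mul_cdf_of_isFar D w hα hl hr hfar
      have h2 : 2 * η ≤ side B w g * δ := by
        rw [hσδ, hη, mul_comm α]
        gcongr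
      -- At a far visit the drift factor is at most `1 - 4η²`, and Bernoulli's inequality bounds
      -- this by `(1 - η²)^4`: hence the exponent `4` in `potential`.
      have hbern := one_add_mul_le_pow (a := -η ^ 2) (by nlinarith) 4
      simp only [hk, if_pos hfar, mul_one]
      rw [← sub_eq_add_neg] at hbern
      refine le_trans ?_ hbern
      push_cast
      nlinarith
    · have := mul_nonneg hγpos.le (side_mul_cdf_nonneg D w hl hr)
      simp only [hk, if_neg hfar, mul_zero, pow_zero]
      rw [hσδ]
      nlinarith
  have hpot : 0 ≤ potential B η (IsFar D α) g t y := by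
    have := hwpos g
    rw [potential, ← hw]
    positivity
  rw [Fintype.sum_bool, htrue, hfalse, hstep, hstep]
  have hinv := expect_inv_le h0 h1 (abs_side_le_one hB hwpos g) hδle
  calc _ = potential B η (IsFar D α) g t y * ((1 - η ^ 2) * ((1 - η ^ 2) ^ (4 * k))⁻¹) *
        ((1 / 2 + δ) * (1 + η * side B w g)⁻¹ + (1 / 2 - δ) * (1 - η * side B w g)⁻¹) := by
        simp only [reportSign, if_true, Bool.false_eq_true, if_false]
        ring_nf
    _ ≤ potential B η (IsFar D α) g t y * ((1 - η ^ 2) * ((1 - η ^ 2) ^ (4 * k))⁻¹) *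
        ((1 - η ^ 2) ^ (4 * k) * (1 - η ^ 2)⁻¹) := by
        refine mul_le_mul_of_nonneg_left (hinv.trans ?_) (by positivity)
        gcongr
    _ = potential B η (IsFar D α) g t y := by
        field_simp

lemma expect_potential_le_one (hB : 1 ≤ B) {α : ℝ} (hα : 0 < α) (h0 : 0 < η) (h1 : η < 1)
    (hη : 2 * η = α * ((Real.exp ε - 1) / (Real.exp ε + 1))) (D : PMF (Dom B)) {g : ℕ}
    (hl : cdf D g ≤ 1 / 2) (hr : 1 / 2 ≤ cdf D (g + 1)) (t : ℕ) :
    (searchProtocol B n hB ε η).expect D t (potential B η (IsFar D α) g t) ≤ 1 := by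
  induction t with
  | zero =>
    rw [Protocol.expect]
    refine (sum_le_sum (g := fun y => ((searchProtocol B n hB ε η).reports D 0 y).toReal)
      fun y _ => ?_).trans (sum_toReal_pmf _).le
    simp [potential, weight, visitsTo, visits]
  | succ t ih =>
    rw [Protocol.expect_succ]
    exact (Protocol.expect_mono _ D fun y =>
      sum_potential_snoc_le hB hα h0 h1 hη D hl hr t y).trans ih

/-- The final gap is far from the median only if the potential is large. -/
lemma one_le_mul_potential (hB : 1 ≤ B) {α : ℝ} (h0 : 0 < η) (h1 : η < 1) (D : PMF (Dom B))
    {g : ℕ} (hg : g < B) (y : Fin n → Bool) (hfar : IsFar D α (finalGap B η n y)) :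
    1 ≤ B * Real.exp (-(η ^ 2 * n)) * potential B η (IsFar D α) g n y := by
  have hvis : n ≤ 2 * visitsTo B η (IsFar D α) n y := by
    -- By monotonicity of `F`, being far on the right propagates upwards and being far on the left
    -- propagates downwards.
    refine le_two_mul_visitsTo hB h0 h1 n y _ ?_
    rcases hfar with h | h
    · exact Or.inl fun g' hg' => Or.inl (h.trans (cdf_mono D hg'))
    · exact Or.inr fun g' hg' => Or.inr ((cdf_mono D (by omega)).trans h)
  have hq : 0 < 1 - η ^ 2 := by nlinarith
  have hw := weight_pos hB h0 h1 n y g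
  have hexp : (1 - η ^ 2) ^ n ≤ Real.exp (-(η ^ 2 * n)) := by
    rw [show -(η ^ 2 * n) = n * (-η ^ 2) by ring, Real.exp_nat_mul]
    gcongr
    linarith [Real.add_one_le_exp (-η ^ 2)]
  -- `4 * visitsTo` is at least `2n`: one factor `(1 - η²)^n` cancels the time factor of the
  -- potential, the other one beats `B`.
  have hpow : (1 - η ^ 2) ^ (4 * visitsTo B η (IsFar D α) n y) ≤
      (1 - η ^ 2) ^ n * (1 - η ^ 2) ^ n := by
    rw [← pow_add]
    exact pow_le_pow_of_le_one hq.le (by nlinarith) (by omega)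
  rw [potential, show ∀ a b c d e : ℝ, a * b * (c * d⁻¹ * e⁻¹) = a * b * c / (d * e) by
    intros; field_simp, one_le_div (by positivity)]
  calc _ ≤ (B : ℝ) * ((1 - η ^ 2) ^ n * (1 - η ^ 2) ^ n) := by
        gcongr
        exact weight_le hB h0 h1 n y hg
    _ ≤ _ := by
        rw [← mul_assoc]
        gcongr

/-- Markov's inequality in pointwise form: the success indicator dominates `1` minus the scaled
potential. -/
lemma le_prob_searchProtocol (hB : 1 ≤ B) {α : ℝ} (hα : 0 < α) (h0 : 0 < η) (h1 : η < 1)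
    (hη : 2 * η = α * ((Real.exp ε - 1) / (Real.exp ε + 1))) (D : PMF (Dom B))
    (S : Set (Dom B)) (hS : ∀ y : Fin n → Bool, ¬ IsFar D α (finalGap B η n y) →
      (searchProtocol B n hB ε η).estimate y ∈ S) :
    1 - B * Real.exp (-(η ^ 2 * n)) ≤ (searchProtocol B n hB ε η).prob D S := by
  classical
  obtain ⟨g, hg, hl, hr⟩ := exists_crossing D hB
  have hE := expect_potential_le_one (n := n) hB hα h0 h1 hη D hl hr n
  have hpot : ∀ y : Fin n → Bool, 0 ≤ potential B η (IsFar D α) g n y := fun y => by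
    have := weight_pos hB h0 h1 n y g
    have hq : 0 < 1 - η ^ 2 := by nlinarith
    rw [potential]
    positivity
  calc 1 - B * Real.exp (-(η ^ 2 * n))
      ≤ 1 - B * Real.exp (-(η ^ 2 * n)) *
          (searchProtocol B n hB ε η).expect D n (potential B η (IsFar D α) g n) :=
        sub_le_sub_left (mul_le_of_le_one_right (by positivity) hE) 1
    _ = (searchProtocol B n hB ε η).expect D n fun y =>
          1 - B * Real.exp (-(η ^ 2 * n)) * potential B η (IsFar D α) g n y :=
        (Protocol.expect_one_sub_mul _ D n _ _).symm
    _ ≤ (searchProtocol B n hB ε η).prob D S := by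
        rw [Protocol.prob_eq_expect]
        refine Protocol.expect_mono _ D fun y => ?_
        by_cases hfar : IsFar D α (finalGap B η n y)
        · have := one_le_mul_potential hB h0 h1 D hg y hfar
          split_ifs <;> linarith
        · rw [if_pos (hS y hfar)]
          have := mul_nonneg (by positivity : 0 ≤ B * Real.exp (-(η ^ 2 * n))) (hpot y)
          linarith

end Search

end LDPMedian

/-- With high probability in `B` means: for every `c > 0`, with probability at least `1 - B^(-c)`
once the universal constant `C` is large enough in terms of `c`. A distribution has no
`α`-approximate median in `[B]` exactly if the point `1` has mass at least `1/2 + α`;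
in that case the protocol has to return `1`. -/
theorem mainTheorem8 (c : ℝ) (hc : 0 < c) :
    ∃ C : ℝ, 0 < C ∧
      ∀ (B n : ℕ) (α ε : ℝ), 1 ≤ B → 0 < α → α < 1 / 4 → 0 < ε →
        C * (Real.log B / α ^ 2) * ((Real.exp ε + 1) / (Real.exp ε - 1)) ^ 2 ≤ (n : ℝ) →
        ∃ (Y : Type) (P : LDPMedian.Protocol B n Y), P.IsLDP ε ∧
          ∀ D : PMF (LDPMedian.Dom B),
            ((∃ m, LDPMedian.IsApproxMedian D α m) →
              1 - (B : ℝ) ^ (-c) ≤ P.prob D {m | LDPMedian.IsApproxMedian D α m}) ∧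
            ((¬ ∃ m, LDPMedian.IsApproxMedian D α m) →
              1 - (B : ℝ) ^ (-c) ≤ P.prob D {m | (m : ℕ) = 1}) := by
  -- The `4` cancels that of `η² = α²γ²/4`, giving `η²n ≥ (1 + c) log B`; the summand `1` absorbs
  -- the prefactor `B` of the failure bound.
  refine ⟨4 * (1 + c), by positivity, fun B n α ε hB hα hα' hε hn => ?_⟩
  have he : 1 < Real.exp ε := Real.one_lt_exp_iff.2 hε
  have hBpos : (0 : ℝ) < B := by exact_mod_cast hB
  set γ := (Real.exp ε - 1) / (Real.exp ε + 1) with hγ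
  have hγpos : 0 < γ := div_pos (by linarith) (by linarith)
  have hγlt : γ < 1 := (div_lt_one (by linarith)).2 (by linarith)
  obtain ⟨η, hη⟩ : ∃ η, 2 * η = α * γ := ⟨α * γ / 2, by ring⟩
  have h0 : 0 < η := by nlinarith [mul_pos hα hγpos]
  have h1 : η < 1 := by nlinarith
  have hbound : (B : ℝ) * Real.exp (-(η ^ 2 * n)) ≤ (B : ℝ) ^ (-c) := by
    have hn' : (1 + c) * Real.log B ≤ η ^ 2 * n := by
      have hinv : (Real.exp ε + 1) / (Real.exp ε - 1) = γ⁻¹ := by rw [hγ, inv_div]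
      rw [hinv] at hn
      calc (1 + c) * Real.log B
          = η ^ 2 * (4 * (1 + c) * (Real.log B / α ^ 2) * γ⁻¹ ^ 2) := by
            rw [show η = α * γ / 2 by linarith]
            field_simp
            ring
        _ ≤ η ^ 2 * n := by gcongr
    calc (B : ℝ) * Real.exp (-(η ^ 2 * n))
        ≤ Real.exp (Real.log B) * Real.exp (-((1 + c) * Real.log B)) := by
          rw [Real.exp_log hBpos]
          gcongr
      _ = (B : ℝ) ^ (-c) := by
          rw [← Real.exp_add, Real.rpow_def_of_pos hBpos]
          congr 1
          ring
  refine ⟨Bool, LDPMedian.searchProtocol B n hB ε η, LDPMedian.searchProtocol_isLDP hB hε,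
    fun D => ⟨fun hex => ?_, fun hex => ?_⟩⟩
  · refine le_trans (by linarith)
      (LDPMedian.le_prob_searchProtocol hB hα h0 h1 hη D _ fun y hy => ?_)
    exact LDPMedian.isApproxMedian_of_not_isFar hα hy _ rfl hex
  · refine le_trans (by linarith)
      (LDPMedian.le_prob_searchProtocol hB hα h0 h1 hη D _ fun y hy => ?_)
    have := LDPMedian.eq_zero_of_not_isFar hα hy (LDPMedian.finalGap_lt hB n y) hex
    simp [LDPMedian.searchProtocol, this]
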